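/- Tasks $k=1,2,\dots$ pass through a tandem of two first-come first-served single-server queues, a transmitter followed by a computational node, with transmission times $S_{k,t}\ge 0$ and computation times $S_{k,c}\ge 0$. Task $k$ arrives at time $\tau_k=X_1+\dots+X_k$ ($\tau_0=0$) with $X_k\ge 0$, its computation starts at $\tau_k''$ and is completed at $\tau_k'=\tau_k''+S_{k,c}$, and its delay is $T_k=\tau_k'-\tau_k$; each server may start with an arbitrary (random) backlog at time $0$. Let $G(t)=\max\{k\ge1:\tau_k'\le t\}$ and $P(t)=\max\{k\ge1:\tau_k''\le t\}$ (with $\max\emptyset=0$), and for a deadline $w>0$ let $A(t)$ be the number of $1\le k\le G(t)$ with $T_k>w$. Under the soft deadline every task is valid, so the informative task is $N(t)=G(t)$, and the age of computing (AoC) is $$c_{\mathrm{soft}}(t)=t-\tau_{N(t)}+1_{\{P(t)>G(t)\}}\,\frac{A(t)}{G(t)}\,\bigl(t-\tau_{P(t)}-w\bigr)^+,$$ where $A(t)/G(t)=0$ if $G(t)=0$. Assume that the sequence $(X_k,S_{k,c},T_k)_{k\ge1}$ is stationary and ergodic (for instance i.i.d.), with $\mathbb E[X_k]>0$, $\mathbb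 E[X_k^2]<\infty$ and $\mathbb E[T_k^2]<\infty$. Then, almost surely, $c_{\mathrm{soft}}$ is integrable on every bounded interval $[0,t]$ and the time-average AoC exists and equals, for every $k\ge 1$, $$\lim_{t\to\infty}\frac1t\int_0^t c_{\mathrm{soft}}(s)\,ds=\frac{\mathbb E[X_kT_k]+\frac12\mathbb E[X_k^2]}{\mathbb E[X_k]}+\epsilon_w\cdot\frac{\mathbb E\bigl[((T_k-w)^+)^2\bigr]-\mathbb E\bigl[((T_k-S_{k,c}-w)^+)^2\bigr]}{2\,\mathbb E[X_k]},\qquad \epsilon_w=\Pr(T_k>w).$$ -/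

import Mathlib

open MeasureTheory Filter Topology

noncomputable section

/-- One realization of the input data of a two-stage tandem of first-come first-served single-server
queues (a transmitter followed by a computational node). Tasks are numbered `1, 2, 3, …`;
the values of `X`, `St`, `Sc` at the index `0` are never used. -/
structure TandemPath where
  /-- The time at which the transmitter has cleared the backlog present at time `0`. -/
  txFree : ℝ
  /-- The time at which the computational node has cleared the backlog present at time `0`. -/
  compFree : ℝ
  /-- `X k` is the time between the arrivals of tasks `k - 1` and `k`
  (for `k = 1`, between time `0` and the first arrival). -/
  X : ℕ → ℝ
  /-- `St k` is the transmission (service) time of task `k`. -/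
  St : ℕ → ℝ
  /-- `Sc k` is the computation (service) time of task `k`. -/
  Sc : ℕ → ℝ

namespace TandemPath

/-- Arrival time `τ k` of task `k` at the source; `τ 0 = 0` is the time origin. -/
def arrival (q : TandemPath) (k : ℕ) : ℝ := ∑ i ∈ Finset.Icc 1 k, q.X i

/-- Time at which the transmission of task `k` ends. -/
def txDone (q : TandemPath) : ℕ → ℝ
  | 0 => q.txFree
  | k + 1 => max (q.arrival (k + 1)) (txDone q k) + q.St (k + 1)

/-- Time `τ' k` at which the computation of task `k` is completed. -/
def compDone (q : TandemPath) : ℕ → ℝ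
  | 0 => q.compFree
  | k + 1 => max (q.txDone (k + 1)) (compDone q k) + q.Sc (k + 1)

/-- Time `τ'' k` at which the computation of task `k` starts (only used for `k ≥ 1`). -/
def compStart (q : TandemPath) : ℕ → ℝ
  | 0 => q.compFree
  | k + 1 => max (q.txDone (k + 1)) (q.compDone k)

/-- Delay (system time) `T k = τ' k - τ k` of task `k`. -/
def delay (q : TandemPath) (k : ℕ) : ℝ := q.compDone k - q.arrival k

/-- Index of the informative task: the largest valid task completed by time `t`
(`0` if there is none). -/
def informative (q : TandemPath) (valid : ℕ → Prop) (t : ℝ) : ℕ :=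
  sSup {k : ℕ | 1 ≤ k ∧ q.compDone k ≤ t ∧ valid k}

/-- Index of the processing task: the largest task whose computation has started by time `t`
(`0` if there is none). -/
def processing (q : TandemPath) (t : ℝ) : ℕ := sSup {k : ℕ | 1 ≤ k ∧ q.compStart k ≤ t}

/-- Index of the latest task: the largest task completed by time `t` (`0` if there is none). -/
def latest (q : TandemPath) (t : ℝ) : ℕ := sSup {k : ℕ | 1 ≤ k ∧ q.compDone k ≤ t}

/-- Number of tasks completed by time `t` whose delay exceeds `w`. -/
def numExceed (q : TandemPath) (w t : ℝ) : ℕ :=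
  Set.ncard {k : ℕ | 1 ≤ k ∧ k ≤ q.latest t ∧ w < q.delay k}

/-- The age of computing under the soft deadline `w`. Under the soft deadline every task is
valid. While no task has been completed, the ratio is `0 / 0 = 0`. -/
def softAoC (q : TandemPath) (w t : ℝ) : ℝ :=
  (t - q.arrival (q.informative (fun _ => True) t)) +
    (if q.latest t < q.processing t then
      ((q.numExceed w t : ℝ) / (q.latest t : ℝ)) * max (t - q.arrival (q.processing t) - w) 0
    else 0)

end TandemPath

/-- A sequence of measurable random elements `Z 0, Z 1, …` is stationary and ergodic: the shift
preserves its law on the sequence space and is ergodic for it. -/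
def IsStationaryErgodic {Ω E : Type*} [MeasurableSpace Ω] [MeasurableSpace E]
    (μ : Measure Ω) (Z : ℕ → Ω → E) : Prop :=
  (∀ n, Measurable (Z n)) ∧
    Ergodic (fun (z : ℕ → E) (n : ℕ) => z (n + 1)) (μ.map (fun ω n => Z n ω))

/-- `Θ` is the time average `lim_{t → ∞} (1/t) ∫_0^t c(s) ds` of the function `c`, where `c` is
integrable on every interval `[0, t]`. -/
def HasTimeAverage (c : ℝ → ℝ) (Θ : ℝ) : Prop :=
  (∀ t : ℝ, 0 ≤ t → IntervalIntegrable c volume 0 t) ∧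
    Tendsto (fun t : ℝ => (1 / t) * ∫ s in (0 : ℝ)..t, c s) atTop (𝓝 Θ)

end

/-! Time is cut at the completions. On cycle n, from τ'_n (from 0 if n = 0) to τ'_{n+1}, the age is
t - τ_n plus, once task n+1 is being computed, (A_n/n)(t - τ_{n+1} - w)^+, where A_n counts the
delays above w among the first n tasks. The cycle integrals are elementary, and since (T + X)² = 2XT
+ X² + T², the squared delays telescope: only sums of XT and X²/2, the penalty terms and a boundary
term T_m²/2 remain (`integral_softAoC_cycleStart`).

Birkhoff's theorem, proved by Garsia's maximal argument, gives the limits of all empirical averages,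
in particular A_n/n → ε_w. A convergent weight factors out of a Cesàro limit of nonnegative terms
(`tendsto_weighted_average`), so the dependence between A_n/n and T_{n+1} is harmless. Convergence
of the averages of T² forces T_n²/n → 0, which kills the boundary term and gives τ'_n/n → E[X].
Since the age is nonnegative, its integral is monotone, and the limit along completion times extends
to all t (`tendsto_div_of_renewal`). -/

/-! ### The pointwise ergodic theorem for ergodic maps -/

section PointwiseErgodic

variable {α : Type*}

/-- Running maximum of the Birkhoff sums of `g` of length at most `n`. -/
noncomputable def maxBirkhoffSum (f : α → α) (g : α → ℝ) : ℕ → α → ℝ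
  | 0, _ => 0
  | n + 1, x => max 0 (g x + maxBirkhoffSum f g n (f x))

theorem maxBirkhoffSum_nonneg (f : α → α) (g : α → ℝ) (n : ℕ) (x : α) :
    0 ≤ maxBirkhoffSum f g n x := by
  cases n with
  | zero => exact le_rfl
  | succ n => exact le_max_left _ _

theorem maxBirkhoffSum_le_succ (f : α → α) (g : α → ℝ) (n : ℕ) (x : α) :
    maxBirkhoffSum f g n x ≤ maxBirkhoffSum f g (n + 1) x := by
  induction n generalizing x with
  | zero => exact maxBirkhoffSum_nonneg f g 1 x
  | succ n ih => exact max_le_max le_rfl (add_le_add le_rfl (ih (f x)))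

theorem birkhoffSum_le_maxBirkhoffSum (f : α → α) (g : α → ℝ) (n : ℕ) (x : α) :
    birkhoffSum f g n x ≤ maxBirkhoffSum f g n x := by
  induction n generalizing x with
  | zero => simp [maxBirkhoffSum]
  | succ n ih =>
    rw [birkhoffSum_succ']
    exact (add_le_add le_rfl (ih (f x))).trans (le_max_right _ _)

/-- Makes the set where the maxima stay bounded exactly invariant, so that ergodicity gives it a
zero-one law. -/
theorem bddAbove_maxBirkhoffSum_apply_iff (f : α → α) (g : α → ℝ) (x : α) :
    BddAbove (Set.range fun n => maxBirkhoffSum f g n (f x)) ↔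
      BddAbove (Set.range fun n => maxBirkhoffSum f g n x) := by
  constructor
  · rintro ⟨B, hB⟩
    refine ⟨max 0 (g x + B), ?_⟩
    rintro _ ⟨n, rfl⟩
    exact (maxBirkhoffSum_le_succ f g n x).trans
      (max_le_max le_rfl (add_le_add le_rfl (hB ⟨n, rfl⟩)))
  · rintro ⟨B, hB⟩
    refine ⟨B - g x, ?_⟩
    rintro _ ⟨n, rfl⟩
    have h1 : maxBirkhoffSum f g (n + 1) x ≤ B := hB ⟨n + 1, rfl⟩
    have h2 : g x + maxBirkhoffSum f g n (f x) ≤ maxBirkhoffSum f g (n + 1) x := le_max_right _ _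
    change maxBirkhoffSum f g n (f x) ≤ B - g x
    linarith

variable [MeasurableSpace α] {μ : Measure α} {f : α → α} {g : α → ℝ}

theorem measurable_maxBirkhoffSum (hf : Measurable f) (hg : Measurable g) (n : ℕ) :
    Measurable (maxBirkhoffSum f g n) := by
  induction n with
  | zero => exact measurable_const
  | succ n ih => exact measurable_const.max (hg.add (ih.comp hf))

theorem integrable_maxBirkhoffSum [IsFiniteMeasure μ] (hf : MeasurePreserving f μ μ)
    (hg : Integrable g μ) (n : ℕ) : Integrable (maxBirkhoffSum f g n) μ := by
  induction n with
  | zero => exact integrable_zero α ℝ μ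
  | succ n ih =>
    exact (integrable_const (0 : ℝ)).sup (hg.add (hf.integrable_comp_of_integrable ih))

/-- The Birkhoff sums of a function with negative integral are almost surely bounded above. -/
theorem Ergodic.ae_bddAbove_maxBirkhoffSum [IsFiniteMeasure μ] (hf : Ergodic f μ)
    (hgm : Measurable g) (hg : Integrable g μ) (hneg : ∫ x, g x ∂μ < 0) :
    ∀ᵐ x ∂μ, BddAbove (Set.range fun n => maxBirkhoffSum f g n x) := by
  have hfp : MeasurePreserving f μ μ := hf.toMeasurePreserving
  have hmeas : MeasurableSet {x | BddAbove (Set.range fun n => maxBirkhoffSum f g n x)} :=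
    measurableSet_bddAbove_range (fun n => measurable_maxBirkhoffSum hfp.measurable hgm n)
  rcases hf.toPreErgodic.ae_mem_or_ae_notMem hmeas
    (Set.ext fun x => bddAbove_maxBirkhoffSum_apply_iff f g x) with h | h
  · exact h
  exfalso
  -- Garsia's argument: if the maxima M_n were unbounded a.e., then max(-M_n ∘ f, g) would tend to
  -- g, dominated by |g|. This maximum equals M_{n+1} - M_n ∘ f, whose integral is nonnegative by
  -- invariance and monotonicity in n, contradicting ∫ g < 0.
  have hlim : Tendsto (fun n => ∫ x, max (-maxBirkhoffSum f g n (f x)) (g x) ∂μ) atTop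
      (𝓝 (∫ x, g x ∂μ)) := by
    refine tendsto_integral_of_dominated_convergence (fun x => |g x|) (fun n => ?_) hg.abs
      (fun n => ?_) ?_
    · exact (((measurable_maxBirkhoffSum hfp.measurable hgm n).comp
        hfp.measurable).neg.max hgm).aestronglyMeasurable
    · refine Eventually.of_forall fun x => ?_
      have h0 := maxBirkhoffSum_nonneg f g n (f x)
      rw [Real.norm_eq_abs, abs_le]
      exact ⟨(neg_abs_le _).trans (le_max_right _ _),
        max_le (by linarith [abs_nonneg (g x)]) (le_abs_self _)⟩
    · filter_upwards [h] with x hx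
      have hx' : ¬ BddAbove (Set.range fun n => maxBirkhoffSum f g n (f x)) := fun hb =>
        hx ((bddAbove_maxBirkhoffSum_apply_iff f g x).1 hb)
      have htop : Tendsto (fun n => maxBirkhoffSum f g n (f x)) atTop atTop :=
        (tendsto_atTop_of_monotone (monotone_nat_of_le_succ
          fun n => maxBirkhoffSum_le_succ f g n (f x))).resolve_right fun ⟨l, hl⟩ =>
            hx' hl.bddAbove_range
      refine tendsto_const_nhds.congr' ?_
      filter_upwards [htop.eventually_ge_atTop (-g x)] with n hn
      exact (max_eq_right (by linarith)).symm
  refine absurd (ge_of_tendsto' hlim fun n => ?_) (not_le.2 hneg)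
  have hi := integrable_maxBirkhoffSum hfp hg n
  have hi1 := integrable_maxBirkhoffSum hfp hg (n + 1)
  have hic := hfp.integrable_comp_of_integrable hi
  have heq : ∀ x, max (-maxBirkhoffSum f g n (f x)) (g x) =
      maxBirkhoffSum f g (n + 1) x - maxBirkhoffSum f g n (f x) := fun x => by
    rw [maxBirkhoffSum, max_sub_sub_right (0 : ℝ) _ _ |>.symm]
    congr 1 <;> ring
  have hcomp : ∫ x, maxBirkhoffSum f g n (f x) ∂μ = ∫ x, maxBirkhoffSum f g n x ∂μ := by
    have := integral_map (μ := μ) hfp.measurable.aemeasurable (f := maxBirkhoffSum f g n)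
      (measurable_maxBirkhoffSum hfp.measurable hgm n).aestronglyMeasurable
    rw [hfp.map_eq] at this
    exact this.symm
  have hsub : ∫ x, maxBirkhoffSum f g (n + 1) x - maxBirkhoffSum f g n (f x) ∂μ =
      ∫ x, maxBirkhoffSum f g (n + 1) x ∂μ - ∫ x, maxBirkhoffSum f g n (f x) ∂μ :=
    integral_sub hi1 hic
  simp_rw [heq]
  rw [hsub, hcomp, sub_nonneg]
  exact integral_mono hi hi1 (maxBirkhoffSum_le_succ f g n)

/-- For d just above the mean, g - d has negative integral, so its Birkhoff sums are bounded by some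
B and those of g by nd + B. Countably many d suffice, which keeps the null set independent of c. -/
theorem Ergodic.ae_eventually_birkhoffSum_lt [IsProbabilityMeasure μ] (hf : Ergodic f μ)
    (hgm : Measurable g) (hg : Integrable g μ) :
    ∀ᵐ x ∂μ, ∀ c, ∫ x, g x ∂μ < c → ∀ᶠ n : ℕ in atTop, birkhoffSum f g n x / n < c := by
  have key : ∀ k : ℕ, ∀ᵐ x ∂μ, BddAbove (Set.range fun n =>
      maxBirkhoffSum f (fun x => g x - (∫ x, g x ∂μ + 1 / ((k : ℝ) + 1))) n x) := fun k => by
    refine hf.ae_bddAbove_maxBirkhoffSum (hgm.sub measurable_const)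
      (hg.sub (integrable_const _)) ?_
    rw [integral_sub hg (integrable_const _)]
    have : (0 : ℝ) < 1 / ((k : ℝ) + 1) := by positivity
    simp
    positivity
  filter_upwards [ae_all_iff.2 key] with x hx c hc
  obtain ⟨k, hk⟩ := exists_nat_one_div_lt (sub_pos.2 hc)
  obtain ⟨B, hB⟩ := hx k
  set d := ∫ x, g x ∂μ + 1 / ((k : ℝ) + 1) with hd
  have hdc : d < c := by linarith
  obtain ⟨m, hm⟩ := exists_nat_gt (B / (c - d))
  filter_upwards [eventually_ge_atTop m, eventually_gt_atTop 0] with n hn hn0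
  have hn0' : (0 : ℝ) < n := Nat.cast_pos.2 hn0
  have h1 : birkhoffSum f (fun x => g x - d) n x ≤ B :=
    (birkhoffSum_le_maxBirkhoffSum f _ n x).trans (hB ⟨n, rfl⟩)
  have h2 : birkhoffSum f (fun x => g x - d) n x = birkhoffSum f g n x - n * d := by
    simp [birkhoffSum, Finset.sum_sub_distrib]
  have h3 : B < n * (c - d) := by
    have : B / (c - d) < n := hm.trans_le (Nat.cast_le.2 hn)
    rwa [div_lt_iff₀ (by linarith)] at this
  rw [div_lt_iff₀ hn0']
  nlinarith

/-- **Birkhoff's pointwise ergodic theorem** for an ergodic map of a probability space. -/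
theorem Ergodic.ae_tendsto_birkhoffSum_div [IsProbabilityMeasure μ] (hf : Ergodic f μ)
    (hgm : Measurable g) (hg : Integrable g μ) :
    ∀ᵐ x ∂μ, Tendsto (fun n : ℕ => birkhoffSum f g n x / n) atTop (𝓝 (∫ x, g x ∂μ)) := by
  filter_upwards [hf.ae_eventually_birkhoffSum_lt hgm hg,
    hf.ae_eventually_birkhoffSum_lt hgm.neg hg.neg] with x h1 h2
  refine tendsto_order.2 ⟨fun c hc => ?_, fun c hc => h1 c hc⟩
  have h3 : ∫ x, (-g) x ∂μ < -c := by
    simp only [Pi.neg_apply, integral_neg]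
    linarith
  filter_upwards [h2 (-c) h3] with n hn
  rw [birkhoffSum_neg, neg_div] at hn
  linarith

end PointwiseErgodic

/-! ### Limits of weighted averages and of monotone functions along a renewal sequence -/

theorem tendsto_weighted_average {r D : ℕ → ℝ} {ε d : ℝ} (hD : ∀ n, 0 ≤ D n)
    (hr : Tendsto r atTop (𝓝 ε))
    (hd : Tendsto (fun n : ℕ => (∑ i ∈ Finset.range n, D i) / n) atTop (𝓝 d)) :
    Tendsto (fun n : ℕ => (∑ i ∈ Finset.range n, r i * D i) / n) atTop (𝓝 (ε * d)) := by
  have hr0 : (fun i => r i - ε) =o[atTop] (fun _ => (1 : ℝ)) := by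
    rw [Asymptotics.isLittleO_one_iff]
    simpa using hr.sub_const ε
  -- The added 1 makes the comparison sums diverge, as summing a little-o requires, even when the
  -- sums of D stay bounded.
  have hlo : (fun i => (r i - ε) * D i) =o[atTop] (fun i => D i + 1) := by
    have h := hr0.mul_isBigO (f₂ := D) (g₂ := fun i => D i + 1) (l := atTop) <|
      Asymptotics.IsBigO.of_bound 1 <| Eventually.of_forall fun i => by
        rw [Real.norm_of_nonneg (hD i), Real.norm_of_nonneg (by linarith [hD i])]
        linarith
    simpa using h
  have hsum : ∀ n : ℕ, ∑ i ∈ Finset.range n, (D i + 1) = ∑ i ∈ Finset.range n, D i + n :=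
    fun n => by simp [Finset.sum_add_distrib]
  have hlo' := hlo.sum_range (fun i => by simpa using add_nonneg (hD i) zero_le_one) <| by
    refine tendsto_atTop_mono (fun n => ?_) tendsto_natCast_atTop_atTop
    rw [hsum]
    linarith [Finset.sum_nonneg fun i (_ : i ∈ Finset.range n) => hD i]
  have hO : (fun n => ∑ i ∈ Finset.range n, (D i + 1)) =O[atTop] (fun n : ℕ => (n : ℝ)) := by
    refine Asymptotics.isBigO_of_div_tendsto_nhds ?_ (d + 1) ?_
    · filter_upwards [eventually_gt_atTop 0] with n hn h0
      exact absurd h0 (Nat.cast_ne_zero.2 hn.ne')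
    · refine (hd.add_const 1).congr' ?_
      filter_upwards [eventually_gt_atTop 0] with n hn
      have : (n : ℝ) ≠ 0 := Nat.cast_ne_zero.2 hn.ne'
      simp only [Pi.div_apply, hsum]
      field_simp
  have h0 := (hlo'.trans_isBigO hO).tendsto_div_nhds_zero
  refine (zero_add (ε * d) ▸ h0.add (hd.const_mul ε)).congr fun n => ?_
  rw [← mul_div_assoc, ← add_div, Finset.mul_sum, ← Finset.sum_add_distrib]
  congr 1
  exact Finset.sum_congr rfl fun i _ => by ring

theorem tendsto_succ_div_natCast {u : ℕ → ℝ} {l : ℝ}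
    (h : Tendsto (fun n : ℕ => u n / n) atTop (𝓝 l)) :
    Tendsto (fun n : ℕ => u (n + 1) / n) atTop (𝓝 l) := by
  have h1 := (tendsto_add_atTop_iff_nat 1).2 h
  have h2 : Tendsto (fun n : ℕ => ((n + 1 : ℕ) : ℝ) / n) atTop (𝓝 1) := by
    have := (tendsto_const_nhds (x := (1 : ℝ))).add
      (tendsto_one_div_atTop_nhds_zero_nat (𝕜 := ℝ))
    rw [add_zero] at this
    refine this.congr' ?_
    filter_upwards [eventually_gt_atTop 0] with n hn
    have : (n : ℝ) ≠ 0 := Nat.cast_ne_zero.2 hn.ne'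
    push_cast
    field_simp
  have h3 := h1.mul h2
  rw [mul_one] at h3
  refine h3.congr fun n => ?_
  have : ((n + 1 : ℕ) : ℝ) ≠ 0 := Nat.cast_ne_zero.2 n.succ_ne_zero
  field_simp

theorem tendsto_div_natCast_zero_of_average {u : ℕ → ℝ} {l : ℝ}
    (h : Tendsto (fun n : ℕ => (∑ i ∈ Finset.range n, u i) / n) atTop (𝓝 l)) :
    Tendsto (fun n : ℕ => u n / n) atTop (𝓝 0) := by
  refine (sub_self l ▸ (tendsto_succ_div_natCast h).sub h).congr fun n => ?_
  rw [← sub_div, Finset.sum_range_succ, add_sub_cancel_left]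

/-- Monotonicity sandwiches F t / t between F(b_N)/b_{N+1} and F(b_{N+1})/b_N, with N = N t; both
tend to L/x. -/
theorem tendsto_div_of_renewal {F : ℝ → ℝ} {b : ℕ → ℝ} {N : ℝ → ℕ} {x L : ℝ}
    (hF : MonotoneOn F (Set.Ici 0)) (hF0 : F 0 = 0) (hb : ∀ n, 0 ≤ b n)
    (hN : ∀ t, 0 ≤ t → b (N t) ≤ t ∧ t < b (N t + 1)) (hNtop : Tendsto N atTop atTop)
    (hx : 0 < x) (hbx : Tendsto (fun n : ℕ => b n / n) atTop (𝓝 x))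
    (hFL : Tendsto (fun n : ℕ => F (b n) / n) atTop (𝓝 L)) :
    Tendsto (fun t => F t / t) atTop (𝓝 (L / x)) := by
  have hlow : Tendsto (fun n : ℕ => F (b n) / b (n + 1)) atTop (𝓝 (L / x)) := by
    refine (hFL.div (tendsto_succ_div_natCast hbx) hx.ne').congr' ?_
    filter_upwards [eventually_gt_atTop 0] with n hn
    exact div_div_div_cancel_right₀ (Nat.cast_ne_zero.2 hn.ne') _ _
  have hupp : Tendsto (fun n : ℕ => F (b (n + 1)) / b n) atTop (𝓝 (L / x)) := by
    refine ((tendsto_succ_div_natCast (u := fun n => F (b n)) hFL).div hbx hx.ne').congr' ?_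
    filter_upwards [eventually_gt_atTop 0] with n hn
    exact div_div_div_cancel_right₀ (Nat.cast_ne_zero.2 hn.ne') _ _
  have hpos : ∀ᶠ n in atTop, 0 < b n := by
    filter_upwards [hbx.eventually (lt_mem_nhds hx)] with n hn
    by_contra h
    exact absurd hn (not_lt.2 (div_nonpos_of_nonpos_of_nonneg (not_lt.1 h) n.cast_nonneg))
  have hnn : ∀ t, 0 ≤ t → 0 ≤ F t := fun t ht =>
    hF0 ▸ hF (Set.mem_Ici.2 le_rfl) (Set.mem_Ici.2 ht) ht
  refine tendsto_of_tendsto_of_tendsto_of_le_of_le' (hlow.comp hNtop) (hupp.comp hNtop) ?_ ?_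
  · filter_upwards [eventually_gt_atTop 0] with t ht
    obtain ⟨h1, h2⟩ := hN t ht.le
    exact div_le_div₀ (hnn t ht.le) (hF (hb _) ht.le h1) ht h2.le
  · filter_upwards [eventually_gt_atTop 0, hNtop.eventually hpos] with t ht hbt
    obtain ⟨h1, h2⟩ := hN t ht.le
    exact div_le_div₀ (hnn _ (hb _)) (hF ht.le (hb _) h2.le) hbt h1

/-! ### Integrals of affine functions and their positive parts -/

theorem hasDerivAt_half_sq_posPart (a x : ℝ) :
    HasDerivAt (fun t : ℝ => 1 / 2 * max (t - a) 0 ^ 2) (max (x - a) 0) x := by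
  have hne : ∀ y : ℝ, y ≠ a →
      HasDerivAt (fun t : ℝ => 1 / 2 * max (t - a) 0 ^ 2) (max (y - a) 0) y := fun y hy => by
    rcases lt_or_gt_of_ne hy with h | h
    · rw [max_eq_right (by linarith)]
      refine (hasDerivAt_const y (0 : ℝ)).congr_of_eventuallyEq ?_
      filter_upwards [Iio_mem_nhds h] with t ht
      rw [max_eq_right (by linarith [Set.mem_Iio.1 ht])]
      simp
    · rw [max_eq_left (by linarith)]
      have h1 : HasDerivAt (fun t : ℝ => 1 / 2 * (t - a) ^ 2) (y - a) y := by
        refine ((((hasDerivAt_id' y).sub_const a).pow 2).const_mul (1 / 2 : ℝ)).congr_deriv ?_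
        push_cast
        ring
      refine h1.congr_of_eventuallyEq ?_
      filter_upwards [Ioi_mem_nhds h] with t ht
      rw [max_eq_left (by linarith [Set.mem_Ioi.1 ht])]
  -- At the kink, the derivative is recovered from its continuous extension.
  rcases eq_or_ne x a with rfl | h
  · exact hasDerivAt_of_hasDerivAt_of_ne (g := fun y => max (y - x) 0) hne
      (by fun_prop) (by fun_prop)
  · exact hne x h

theorem integral_posPart_sub (a u v : ℝ) :
    ∫ t in u..v, max (t - a) 0 = 1 / 2 * (max (v - a) 0 ^ 2 - max (u - a) 0 ^ 2) := by
  rw [intervalIntegral.integral_eq_sub_of_hasDerivAt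
    (fun x _ => hasDerivAt_half_sq_posPart a x) (Continuous.intervalIntegrable (by fun_prop) _ _)]
  ring

theorem integral_id_sub (a u v : ℝ) :
    ∫ t in u..v, (t - a) = 1 / 2 * ((v - a) ^ 2 - (u - a) ^ 2) := by
  rw [intervalIntegral.integral_sub (by simp) (by simp)]
  simp
  ring

/-! ### Sample-path analysis of the tandem queue -/

namespace TandemPath

/-- All interarrival, transmission and computation times are nonnegative. -/
structure NonnegTimes (q : TandemPath) : Prop where
  X : ∀ k, 1 ≤ k → 0 ≤ q.X k
  St : ∀ k, 1 ≤ k → 0 ≤ q.St k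
  Sc : ∀ k, 1 ≤ k → 0 ≤ q.Sc k

/-- Start of the `n`-th renewal cycle: the time origin for `n = 0`, and the completion of task `n`
for `n ≥ 1`. -/
noncomputable def cycleStart (q : TandemPath) : ℕ → ℝ
  | 0 => 0
  | n + 1 => q.compDone (n + 1)

/-- Number of tasks among the first `n` whose delay exceeds `w`. -/
noncomputable def exceedCount (q : TandemPath) (w : ℝ) (n : ℕ) : ℕ :=
  Set.ncard {k : ℕ | 1 ≤ k ∧ k ≤ n ∧ w < q.delay k}

@[simp] theorem arrival_zero (q : TandemPath) : q.arrival 0 = 0 := by simp [arrival]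

theorem arrival_succ (q : TandemPath) (n : ℕ) :
    q.arrival (n + 1) = q.arrival n + q.X (n + 1) :=
  Finset.sum_Icc_succ_top (by omega) _

theorem arrival_eq_sum_range (q : TandemPath) (n : ℕ) :
    q.arrival n = ∑ i ∈ Finset.range n, q.X (i + 1) := by
  induction n with
  | zero => simp
  | succ n ih => rw [arrival_succ, ih, Finset.sum_range_succ]

theorem compDone_succ (q : TandemPath) (n : ℕ) :
    q.compDone (n + 1) = q.compStart (n + 1) + q.Sc (n + 1) := rfl

theorem compDone_le_compStart_succ (q : TandemPath) (n : ℕ) :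
    q.compDone n ≤ q.compStart (n + 1) := le_max_right _ _

theorem exceedCount_eq_sum (q : TandemPath) (w : ℝ) (n : ℕ) :
    (q.exceedCount w n : ℝ) =
      ∑ i ∈ Finset.range n, (Set.Ioi w).indicator (fun _ => (1 : ℝ)) (q.delay (i + 1)) := by
  classical
  have h : {k : ℕ | 1 ≤ k ∧ k ≤ n ∧ w < q.delay k} =
      (((Finset.range n).filter fun i => w < q.delay (i + 1)).image (· + 1) : Finset ℕ) := by
    ext k
    simp only [Set.mem_ofPred_eq, Finset.coe_image, Finset.coe_filter, Finset.mem_range,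
      Set.mem_image]
    constructor
    · rintro ⟨h1, h2, h3⟩
      exact ⟨k - 1, ⟨by omega, by rwa [Nat.sub_add_cancel h1]⟩, by omega⟩
    · rintro ⟨i, ⟨h1, h2⟩, rfl⟩
      exact ⟨by omega, by omega, h2⟩
  rw [exceedCount, h, Set.ncard_coe_finset, Finset.card_image_of_injective _ (add_left_injective 1),
    Finset.card_filter, Nat.cast_sum]
  refine Finset.sum_congr rfl fun i _ => ?_
  simp [Set.indicator_apply]

namespace NonnegTimes

variable {q : TandemPath} (hq : q.NonnegTimes)
include hq

theorem arrival_mono : Monotone q.arrival :=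
  monotone_nat_of_le_succ fun n => by
    rw [arrival_succ]
    linarith [hq.X (n + 1) (by omega)]

theorem arrival_nonneg (n : ℕ) : 0 ≤ q.arrival n :=
  q.arrival_zero ▸ hq.arrival_mono n.zero_le

theorem arrival_le_compStart_succ (n : ℕ) : q.arrival (n + 1) ≤ q.compStart (n + 1) :=
  calc q.arrival (n + 1) ≤ max (q.arrival (n + 1)) (q.txDone n) := le_max_left _ _
    _ ≤ q.txDone (n + 1) := le_add_of_nonneg_right (hq.St (n + 1) (by omega))
    _ ≤ q.compStart (n + 1) := le_max_left _ _

theorem compStart_le_compDone_succ (n : ℕ) : q.compStart (n + 1) ≤ q.compDone (n + 1) :=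
  le_add_of_nonneg_right (hq.Sc (n + 1) (by omega))

theorem compDone_mono : Monotone q.compDone :=
  monotone_nat_of_le_succ fun n =>
    (q.compDone_le_compStart_succ n).trans (hq.compStart_le_compDone_succ n)

theorem cycleStart_le_compStart_succ (n : ℕ) : q.cycleStart n ≤ q.compStart (n + 1) := by
  cases n with
  -- Cycle 0 starts at 0, not at `compDone 0`, which is an arbitrary backlog; the bound therefore
  -- goes through the first arrival.
  | zero => exact (hq.arrival_nonneg 1).trans (hq.arrival_le_compStart_succ 0)
  | succ n => exact q.compDone_le_compStart_succ (n + 1)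

theorem cycleStart_mono : Monotone q.cycleStart :=
  monotone_nat_of_le_succ fun n =>
    (hq.cycleStart_le_compStart_succ n).trans (hq.compStart_le_compDone_succ n)

theorem cycleStart_nonneg (n : ℕ) : 0 ≤ q.cycleStart n := hq.cycleStart_mono n.zero_le

theorem arrival_le_cycleStart (n : ℕ) : q.arrival n ≤ q.cycleStart n := by
  cases n with
  | zero => exact q.arrival_zero.le
  | succ n => exact (hq.arrival_le_compStart_succ n).trans (hq.compStart_le_compDone_succ n)

/-- Completions are ordered, so every task after n finishes at or after `cycleStart (n + 1)`.
Simultaneous completions only create empty cycles, which the two hypotheses rule out. -/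
theorem latest_eq {n : ℕ} {t : ℝ} (h1 : q.cycleStart n ≤ t) (h2 : t < q.cycleStart (n + 1)) :
    q.latest t = n := by
  have hub : ∀ k ∈ {k : ℕ | 1 ≤ k ∧ q.compDone k ≤ t}, k ≤ n := fun k hk => by
    by_contra hkn
    exact absurd (hq.compDone_mono (show n + 1 ≤ k by omega)) (not_le.2 (hk.2.trans_lt h2))
  cases n with
  | zero =>
    have : {k : ℕ | 1 ≤ k ∧ q.compDone k ≤ t} = ∅ :=
      Set.eq_empty_of_forall_notMem fun k hk => by
        have := hub k hk
        have := hk.1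
        omega
    rw [latest, this]
    exact csSup_empty
  | succ n => exact IsGreatest.csSup_eq ⟨⟨by omega, h1⟩, hub⟩

theorem processing_eq {n : ℕ} {t : ℝ} (h1 : q.compStart (n + 1) ≤ t)
    (h2 : t < q.cycleStart (n + 1)) : q.processing t = n + 1 := by
  refine IsGreatest.csSup_eq ⟨⟨by omega, h1⟩, fun k hk => ?_⟩
  by_contra hkn
  obtain ⟨j, rfl⟩ : ∃ j, k = j + 1 := ⟨k - 1, by have := hk.1; omega⟩
  have h3 : q.compDone (n + 1) ≤ q.compDone j := hq.compDone_mono (by omega)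
  exact absurd (h3.trans (q.compDone_le_compStart_succ j)) (not_le.2 (hk.2.trans_lt h2))

theorem processing_le {n : ℕ} {t : ℝ} (h : t < q.compStart (n + 1)) : q.processing t ≤ n := by
  refine csSup_le' fun k hk => ?_
  by_contra hkn
  obtain ⟨j, rfl⟩ : ∃ j, k = j + 1 := ⟨k - 1, by have := hk.1; omega⟩
  have h3 : q.compStart (n + 1) ≤ q.compStart (j + 1) := by
    rcases (show n = j ∨ n + 1 ≤ j by omega) with rfl | hnj
    · exact le_rfl
    · exact (hq.compStart_le_compDone_succ n).trans
        ((hq.compDone_mono hnj).trans (q.compDone_le_compStart_succ j))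
  exact absurd h3 (not_le.2 (hk.2.trans_lt h))

omit hq in
theorem _root_.TandemPath.informative_true (q : TandemPath) (t : ℝ) :
    q.informative (fun _ => True) t = q.latest t := by
  simp [informative, latest]

theorem softAoC_eq_of_lt_compStart (w : ℝ) {n : ℕ} {t : ℝ} (h1 : q.cycleStart n ≤ t)
    (h2 : t < q.compStart (n + 1)) : q.softAoC w t = t - q.arrival n := by
  have hl := hq.latest_eq h1 (h2.trans_le (hq.compStart_le_compDone_succ n))
  rw [softAoC, informative_true, hl, if_neg (not_lt.2 (hq.processing_le h2)), add_zero]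

/-- For n = 0 the ratio is 0 / 0 = 0, matching the convention before the first completion. -/
theorem softAoC_eq_of_compStart_le (w : ℝ) {n : ℕ} {t : ℝ} (h1 : q.compStart (n + 1) ≤ t)
    (h2 : t < q.cycleStart (n + 1)) :
    q.softAoC w t = (t - q.arrival n) +
      (q.exceedCount w n : ℝ) / n * max (t - (q.arrival (n + 1) + w)) 0 := by
  have hl := hq.latest_eq ((hq.cycleStart_le_compStart_succ n).trans h1) h2
  rw [softAoC, informative_true, numExceed, hl, hq.processing_eq h1 h2, if_pos n.lt_succ_self,
    sub_sub]
  rfl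

theorem eqOn_softAoC_idle (w : ℝ) (n : ℕ) :
    Set.EqOn (q.softAoC w) (fun t => t - q.arrival n)
      (Set.uIoo (q.cycleStart n) (q.compStart (n + 1))) := fun t ht => by
  rw [Set.uIoo_of_le (hq.cycleStart_le_compStart_succ n)] at ht
  exact hq.softAoC_eq_of_lt_compStart w ht.1.le ht.2

theorem eqOn_softAoC_busy (w : ℝ) (n : ℕ) :
    Set.EqOn (q.softAoC w) (fun t => (t - q.arrival n) +
      (q.exceedCount w n : ℝ) / n * max (t - (q.arrival (n + 1) + w)) 0)
      (Set.uIoo (q.compStart (n + 1)) (q.cycleStart (n + 1))) := fun t ht => by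
  rw [Set.uIoo_of_le (show _ ≤ q.cycleStart (n + 1) from hq.compStart_le_compDone_succ n)] at ht
  exact hq.softAoC_eq_of_compStart_le w ht.1.le ht.2

theorem intervalIntegrable_softAoC_idle (w : ℝ) (n : ℕ) :
    IntervalIntegrable (q.softAoC w) volume (q.cycleStart n) (q.compStart (n + 1)) :=
  (Continuous.intervalIntegrable (by fun_prop) _ _).congr_uIoo (hq.eqOn_softAoC_idle w n).symm

theorem intervalIntegrable_softAoC_busy (w : ℝ) (n : ℕ) :
    IntervalIntegrable (q.softAoC w) volume (q.compStart (n + 1)) (q.cycleStart (n + 1)) :=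
  (Continuous.intervalIntegrable (by fun_prop) _ _).congr_uIoo (hq.eqOn_softAoC_busy w n).symm

theorem intervalIntegrable_softAoC_cycle (w : ℝ) (n : ℕ) :
    IntervalIntegrable (q.softAoC w) volume (q.cycleStart n) (q.cycleStart (n + 1)) :=
  (hq.intervalIntegrable_softAoC_idle w n).trans (hq.intervalIntegrable_softAoC_busy w n)

/-- The linear age ends the cycle at T_{n+1} + X_{n+1}. Its initial value is kept as `cycleStart n -
arrival n`, since this is T_n for n ≥ 1 but 0 for n = 0, where `delay 0` would be the backlog. -/
theorem integral_softAoC_cycle (w : ℝ) (n : ℕ) :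
    ∫ t in q.cycleStart n..q.cycleStart (n + 1), q.softAoC w t =
      1 / 2 * ((q.delay (n + 1) + q.X (n + 1)) ^ 2 - (q.cycleStart n - q.arrival n) ^ 2) +
        (q.exceedCount w n : ℝ) / n * (1 / 2 * (max (q.delay (n + 1) - w) 0 ^ 2 -
          max (q.delay (n + 1) - q.Sc (n + 1) - w) 0 ^ 2)) := by
  rw [← intervalIntegral.integral_add_adjacent_intervals (hq.intervalIntegrable_softAoC_idle w n)
    (hq.intervalIntegrable_softAoC_busy w n),
    intervalIntegral.integral_congr_uIoo (hq.eqOn_softAoC_idle w n),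
    intervalIntegral.integral_congr_uIoo (hq.eqOn_softAoC_busy w n),
    intervalIntegral.integral_add (Continuous.intervalIntegrable (by fun_prop) _ _)
      (Continuous.intervalIntegrable (by fun_prop) _ _),
    intervalIntegral.integral_const_mul, integral_id_sub, integral_id_sub, integral_posPart_sub]
  have h1 : q.cycleStart (n + 1) = q.delay (n + 1) + q.arrival (n + 1) :=
    (sub_add_cancel _ _).symm
  have h2 : q.compStart (n + 1) = q.delay (n + 1) - q.Sc (n + 1) + q.arrival (n + 1) := by
    rw [delay, compDone_succ]
    ring
  have h3 : q.cycleStart (n + 1) - (q.arrival (n + 1) + w) = q.delay (n + 1) - w := by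
    rw [h1]
    ring
  have h4 : q.compStart (n + 1) - (q.arrival (n + 1) + w) =
      q.delay (n + 1) - q.Sc (n + 1) - w := by
    rw [h2]
    ring
  rw [h3, h4, h1, arrival_succ]
  ring

theorem integral_softAoC_cycleStart (w : ℝ) (m : ℕ) :
    ∫ t in (0 : ℝ)..q.cycleStart m, q.softAoC w t =
      ∑ i ∈ Finset.range m, q.X (i + 1) * q.delay (i + 1) +
        1 / 2 * ∑ i ∈ Finset.range m, q.X (i + 1) ^ 2 +
        1 / 2 * (q.cycleStart m - q.arrival m) ^ 2 +
        1 / 2 * ∑ i ∈ Finset.range m, (q.exceedCount w i : ℝ) / i *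
          (max (q.delay (i + 1) - w) 0 ^ 2 - max (q.delay (i + 1) - q.Sc (i + 1) - w) 0 ^ 2) := by
  have h := intervalIntegral.sum_integral_adjacent_intervals (a := q.cycleStart) (n := m)
    fun k _ => hq.intervalIntegrable_softAoC_cycle w k
  change _ = ∫ t in (0 : ℝ)..q.cycleStart m, q.softAoC w t at h
  rw [← h]
  clear h
  induction m with
  | zero => simp [cycleStart]
  | succ m ih =>
    simp only [Finset.sum_range_succ]
    rw [ih, hq.integral_softAoC_cycle]
    have : q.cycleStart (m + 1) - q.arrival (m + 1) = q.delay (m + 1) := rfl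
    rw [this]
    ring

/-- Every nonnegative time lies in the cycle of the latest task, if the cycles exhaust time. -/
theorem cycleStart_latest_le_lt (htop : Tendsto q.cycleStart atTop atTop) {t : ℝ} (ht : 0 ≤ t) :
    q.cycleStart (q.latest t) ≤ t ∧ t < q.cycleStart (q.latest t + 1) := by
  obtain ⟨m, hm⟩ := (htop.eventually_gt_atTop t).exists
  classical
  have hex : ∃ m, t < q.cycleStart m := ⟨m, hm⟩
  obtain ⟨j, hj⟩ : ∃ j, Nat.find hex = j + 1 := Nat.exists_eq_succ_of_ne_zero fun h0 => by
    have := Nat.find_spec hex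
    rw [h0] at this
    exact absurd ht (not_le.2 this)
  have h1 : q.cycleStart j ≤ t := not_lt.1 (Nat.find_min hex (by omega))
  have h2 : t < q.cycleStart (j + 1) := hj ▸ Nat.find_spec hex
  rw [hq.latest_eq h1 h2]
  exact ⟨h1, h2⟩

theorem tendsto_latest (htop : Tendsto q.cycleStart atTop atTop) :
    Tendsto q.latest atTop atTop := by
  refine tendsto_atTop.2 fun m => ?_
  filter_upwards [eventually_ge_atTop (q.cycleStart m)] with t ht
  have h := hq.cycleStart_latest_le_lt htop ((hq.cycleStart_nonneg m).trans ht)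
  by_contra hlt
  exact absurd (hq.cycleStart_mono (show q.latest t + 1 ≤ m by omega))
    (not_le.2 (ht.trans_lt h.2))

theorem softAoC_nonneg (htop : Tendsto q.cycleStart atTop atTop) (w : ℝ) {t : ℝ} (ht : 0 ≤ t) :
    0 ≤ q.softAoC w t := by
  have h := (hq.cycleStart_latest_le_lt htop ht).1
  have h' := (hq.arrival_le_cycleStart _).trans h
  rw [softAoC, informative_true]
  refine add_nonneg (sub_nonneg.2 h') ?_
  split_ifs
  · positivity
  · exact le_rfl

theorem intervalIntegrable_softAoC (htop : Tendsto q.cycleStart atTop atTop) (w : ℝ) {t : ℝ}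
    (ht : 0 ≤ t) : IntervalIntegrable (q.softAoC w) volume 0 t := by
  obtain ⟨m, hm⟩ := (htop.eventually_gt_atTop t).exists
  have h : IntervalIntegrable (q.softAoC w) volume 0 (q.cycleStart m) :=
    IntervalIntegrable.trans_iterate (a := q.cycleStart)
      fun k _ => hq.intervalIntegrable_softAoC_cycle w k
  refine h.mono_set ?_
  rw [Set.uIcc_of_le ht, Set.uIcc_of_le (ht.trans hm.le)]
  exact Set.Icc_subset_Icc_right hm.le

theorem monotoneOn_integral_softAoC (htop : Tendsto q.cycleStart atTop atTop) (w : ℝ) :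
    MonotoneOn (fun t => ∫ s in (0 : ℝ)..t, q.softAoC w s) (Set.Ici 0) := by
  intro s hs t ht hst
  refine intervalIntegral.integral_mono_interval le_rfl hs hst ?_
    (hq.intervalIntegrable_softAoC htop w ht)
  filter_upwards [ae_restrict_mem measurableSet_Ioc] with u hu
  exact hq.softAoC_nonneg htop w hu.1.le

/-- The time-average age of computing of a sample path whose empirical averages converge. -/
theorem hasTimeAverage_softAoC {w x x2 xT t2 ε d : ℝ} (hx : 0 < x)
    (hX : Tendsto (fun n : ℕ => (∑ i ∈ Finset.range n, q.X (i + 1)) / n) atTop (𝓝 x))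
    (hX2 : Tendsto (fun n : ℕ => (∑ i ∈ Finset.range n, q.X (i + 1) ^ 2) / n) atTop (𝓝 x2))
    (hXT : Tendsto (fun n : ℕ => (∑ i ∈ Finset.range n, q.X (i + 1) * q.delay (i + 1)) / n)
      atTop (𝓝 xT))
    (hT2 : Tendsto (fun n : ℕ => (∑ i ∈ Finset.range n, q.delay (i + 1) ^ 2) / n) atTop (𝓝 t2))
    (hε : Tendsto (fun n : ℕ => (∑ i ∈ Finset.range n,
      (Set.Ioi w).indicator (fun _ => (1 : ℝ)) (q.delay (i + 1))) / n) atTop (𝓝 ε))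
    (hd : Tendsto (fun n : ℕ => (∑ i ∈ Finset.range n, (max (q.delay (i + 1) - w) 0 ^ 2 -
      max (q.delay (i + 1) - q.Sc (i + 1) - w) 0 ^ 2)) / n) atTop (𝓝 d)) :
    HasTimeAverage (q.softAoC w) ((xT + 1 / 2 * x2) / x + ε * (d / (2 * x))) := by
  -- A single term of a convergent average is o(n); the shift by one avoids n = 0, where the
  -- residual is not `delay 0`.
  have hR2 : Tendsto (fun n : ℕ => (q.cycleStart n - q.arrival n) ^ 2 / n) atTop (𝓝 0) := by
    have h := tendsto_div_natCast_zero_of_average hT2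
    refine (tendsto_add_atTop_iff_nat 1).1 ?_
    refine squeeze_zero' (Eventually.of_forall fun n => by positivity) ?_ h
    filter_upwards [eventually_gt_atTop 0] with n hn
    exact div_le_div_of_nonneg_left (sq_nonneg (q.delay (n + 1))) (Nat.cast_pos.2 hn)
      (Nat.cast_le.2 n.le_succ)
  have hR : Tendsto (fun n : ℕ => (q.cycleStart n - q.arrival n) / n) atTop (𝓝 0) := by
    have h := hR2.add (tendsto_one_div_atTop_nhds_zero_nat (𝕜 := ℝ))
    rw [add_zero] at h
    refine squeeze_zero (fun n => div_nonneg (sub_nonneg.2 (hq.arrival_le_cycleStart n))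
      n.cast_nonneg) (fun n => ?_) h
    rw [← add_div]
    refine div_le_div_of_nonneg_right ?_ n.cast_nonneg
    -- r ≤ r² + 1, from (r - 1/2)² ≥ 0.
    nlinarith [sq_nonneg (q.cycleStart n - q.arrival n - 1 / 2)]
  have hb : Tendsto (fun n : ℕ => q.cycleStart n / n) atTop (𝓝 x) := by
    refine (add_zero x ▸ hX.add hR).congr fun n => ?_
    rw [← arrival_eq_sum_range, ← add_div, add_sub_cancel]
  have htop : Tendsto q.cycleStart atTop atTop := by
    refine (hb.pos_mul_atTop hx tendsto_natCast_atTop_atTop).congr' ?_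
    filter_upwards [eventually_gt_atTop 0] with n hn
    exact div_mul_cancel₀ _ (Nat.cast_ne_zero.2 hn.ne')
  have hD : ∀ n, 0 ≤ max (q.delay (n + 1) - w) 0 ^ 2 -
      max (q.delay (n + 1) - q.Sc (n + 1) - w) 0 ^ 2 := fun n => by
    have := hq.Sc (n + 1) (by omega)
    refine sub_nonneg.2 (pow_le_pow_left₀ (le_max_right _ _) (max_le_max ?_ le_rfl) 2)
    linarith
  -- The weight at index n uses tasks 1 to n, while the term it multiplies belongs to task n + 1.
  have hW := tendsto_weighted_average hD
    (r := fun n => (q.exceedCount w n : ℝ) / n) (by simpa only [exceedCount_eq_sum] using hε) hd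
  have hI : Tendsto (fun n : ℕ => (∫ t in (0 : ℝ)..q.cycleStart n, q.softAoC w t) / n) atTop
      (𝓝 (xT + 1 / 2 * x2 + 1 / 2 * 0 + 1 / 2 * (ε * d))) := by
    refine (((hXT.add (hX2.const_mul (1 / 2))).add (hR2.const_mul (1 / 2))).add
      (hW.const_mul (1 / 2))).congr fun n => ?_
    rw [hq.integral_softAoC_cycleStart]
    ring
  refine ⟨fun t ht => hq.intervalIntegrable_softAoC htop w ht, ?_⟩
  have hlim := tendsto_div_of_renewal (N := q.latest) (hq.monotoneOn_integral_softAoC htop w)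
    intervalIntegral.integral_same hq.cycleStart_nonneg
    (fun t ht => hq.cycleStart_latest_le_lt htop ht) (hq.tendsto_latest htop) hx hb hI
  have hval : (xT + 1 / 2 * x2 + 1 / 2 * 0 + 1 / 2 * (ε * d)) / x =
      (xT + 1 / 2 * x2) / x + ε * (d / (2 * x)) := by
    field_simp
    ring
  rw [hval] at hlim
  exact hlim.congr fun t => (one_div_mul_eq_div _ _).symm

end NonnegTimes

end TandemPath

/-! ### Strong law of large numbers for stationary ergodic sequences -/

/-- Birkhoff's theorem for z ↦ G (z 0) under the law of the sequence, pulled back to Ω; invariance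
under the k-th iterate of the shift moves integrability and mean from index k to index 0. -/
theorem IsStationaryErgodic.ae_tendsto_average {Ω E : Type*} [MeasurableSpace Ω]
    [MeasurableSpace E] {μ : Measure Ω} [IsProbabilityMeasure μ] {Z : ℕ → Ω → E}
    (h : IsStationaryErgodic μ Z) {G : E → ℝ} (hG : Measurable G) (k : ℕ)
    (hint : Integrable (fun ω => G (Z k ω)) μ) :
    ∀ᵐ ω ∂μ, Tendsto (fun n : ℕ => (∑ i ∈ Finset.range n, G (Z i ω)) / n) atTop
      (𝓝 (∫ ω, G (Z k ω) ∂μ)) := by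
  obtain ⟨hm, herg⟩ := h
  have hZ : Measurable fun ω n => Z n ω := measurable_pi_lambda _ hm
  set shift : (ℕ → E) → ℕ → E := fun z n => z (n + 1) with hshift
  set ν := μ.map fun ω n => Z n ω with hν
  have : IsProbabilityMeasure ν := Measure.isProbabilityMeasure_map hZ.aemeasurable
  have hiter : ∀ (i : ℕ) (z : ℕ → E) (n : ℕ), shift^[i] z n = z (n + i) := fun i => by
    induction i with
    | zero => exact fun z n => rfl
    | succ i ih =>
      intro z n
      rw [Function.iterate_succ_apply, ih, hshift]
      congr 1
  have hGk : ∀ n : ℕ, Measurable fun z : ℕ → E => G (z n) := fun n =>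
    hG.comp (measurable_pi_apply n)
  have hcomp : (fun z : ℕ → E => G (z 0)) ∘ shift^[k] = fun z => G (z k) := funext fun z => by
    simp [hiter]
  have hσ : MeasurePreserving shift^[k] ν ν := herg.toMeasurePreserving.iterate k
  have hintk : Integrable (fun z : ℕ → E => G (z k)) ν :=
    (integrable_map_measure (hGk k).aestronglyMeasurable hZ.aemeasurable).2 hint
  have hint0 : Integrable (fun z : ℕ → E => G (z 0)) ν := by
    rw [← hcomp] at hintk
    exact (hσ.integrable_comp (hGk 0).aestronglyMeasurable).1 hintk
  have hval : ∫ z, G (z 0) ∂ν = ∫ ω, G (Z k ω) ∂μ := by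
    have h1 : ∫ z, G (z 0) ∂ν = ∫ z, G (z k) ∂ν := by
      conv_lhs => rw [← hσ.map_eq]
      rw [integral_map hσ.measurable.aemeasurable (hGk 0).aestronglyMeasurable]
      exact integral_congr_ae (Eventually.of_forall fun z => congrFun hcomp z)
    rw [h1, hν, integral_map hZ.aemeasurable (hGk k).aestronglyMeasurable]
  have hlim := ae_of_ae_map hZ.aemeasurable (herg.ae_tendsto_birkhoffSum_div (hGk 0) hint0)
  filter_upwards [hlim] with ω hω
  rw [hval] at hω
  refine hω.congr fun n => ?_
  simp [birkhoffSum, hiter]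

/-- Domination by |T|. With S = w and S = Sc + w it makes both penalty terms square integrable, with
no moment assumption on Sc. -/
theorem memLp_posPart_sub {Ω : Type*} [MeasurableSpace Ω] {μ : Measure Ω} {T S : Ω → ℝ}
    {p : ENNReal} (hT : MemLp T p μ) (hS : AEStronglyMeasurable S μ) (hS0 : ∀ᵐ ω ∂μ, 0 ≤ S ω) :
    MemLp (fun ω => max (T ω - S ω) 0) p μ := by
  refine hT.mono ((hT.aestronglyMeasurable.sub hS).sup aestronglyMeasurable_const) ?_
  filter_upwards [hS0] with ω hω
  rw [Real.norm_of_nonneg (le_max_right _ _), Real.norm_eq_abs]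
  exact max_le (by linarith [le_abs_self (T ω)]) (abs_nonneg _)

theorem theorem1 {Ω : Type*} [MeasurableSpace Ω] (μ : Measure Ω) [IsProbabilityMeasure μ]
    (q : Ω → TandemPath) (w : ℝ) (hw : 0 < w)
    (hX : ∀ k, 1 ≤ k → ∀ᵐ ω ∂μ, 0 ≤ (q ω).X k)
    (hSt : ∀ k, 1 ≤ k → ∀ᵐ ω ∂μ, 0 ≤ (q ω).St k)
    (hSc : ∀ k, 1 ≤ k → ∀ᵐ ω ∂μ, 0 ≤ (q ω).Sc k)
    (hstat : IsStationaryErgodic μ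
      (fun n ω => ((q ω).X (n + 1), (q ω).Sc (n + 1), (q ω).delay (n + 1))))
    (k : ℕ) (hk : 1 ≤ k)
    (hX2 : MemLp (fun ω => (q ω).X k) 2 μ)
    (hT2 : MemLp (fun ω => (q ω).delay k) 2 μ)
    (hXpos : 0 < ∫ ω, (q ω).X k ∂μ) :
    ∀ᵐ ω ∂μ, HasTimeAverage ((q ω).softAoC w)
      (((∫ ω', (q ω').X k * (q ω').delay k ∂μ) + (1 / 2) * ∫ ω', (q ω').X k ^ 2 ∂μ)
          / (∫ ω', (q ω').X k ∂μ)
        + μ.real {ω' | w < (q ω').delay k} *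
          (((∫ ω', (max ((q ω').delay k - w) 0) ^ 2 ∂μ)
              - ∫ ω', (max ((q ω').delay k - (q ω').Sc k - w) 0) ^ 2 ∂μ)
            / (2 * ∫ ω', (q ω').X k ∂μ))) := by
  -- The stationary sequence is indexed from 0, so its entry j describes task j + 1.
  obtain ⟨j, rfl⟩ : ∃ j, k = j + 1 := ⟨k - 1, by omega⟩
  have hScm : Measurable fun ω => (q ω).Sc (j + 1) := (hstat.1 j).snd.fst
  have hTm : Measurable fun ω => (q ω).delay (j + 1) := (hstat.1 j).snd.snd
  have hD1 : Integrable (fun ω => max ((q ω).delay (j + 1) - w) 0 ^ 2) μ :=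
    (memLp_posPart_sub (S := fun _ => w) hT2 aestronglyMeasurable_const
      (Eventually.of_forall fun _ => hw.le)).integrable_sq
  have hD2 : Integrable
      (fun ω => max ((q ω).delay (j + 1) - (q ω).Sc (j + 1) - w) 0 ^ 2) μ := by
    have := (memLp_posPart_sub (S := fun ω => (q ω).Sc (j + 1) + w) hT2
      (hScm.add_const w).aestronglyMeasurable
      ((hSc (j + 1) hk).mono fun ω hω => by positivity)).integrable_sq
    simpa only [sub_sub] using this
  have hset : MeasurableSet {ω | w < (q ω).delay (j + 1)} := measurableSet_lt measurable_const hTm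
  have hind : (fun ω => (Set.Ioi w).indicator (fun _ => (1 : ℝ)) ((q ω).delay (j + 1))) =
      {ω | w < (q ω).delay (j + 1)}.indicator fun _ => 1 := rfl
  have h1 := hstat.ae_tendsto_average (G := fun z => z.1) (by fun_prop) j
    (hX2.integrable one_le_two)
  have h2 := hstat.ae_tendsto_average (G := fun z => z.1 ^ 2) (by fun_prop) j hX2.integrable_sq
  have h3 := hstat.ae_tendsto_average (G := fun z => z.1 * z.2.2) (by fun_prop) j
    (hX2.integrable_mul hT2)
  have h4 := hstat.ae_tendsto_average (G := fun z => z.2.2 ^ 2) (by fun_prop) j hT2.integrable_sq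
  have h5 := hstat.ae_tendsto_average
    (G := fun z => (Set.Ioi w).indicator (fun _ => (1 : ℝ)) z.2.2)
    ((measurable_const.indicator measurableSet_Ioi).comp measurable_snd.snd) j
    (by simpa only [hind] using (integrable_const (1 : ℝ)).indicator hset)
  have h6 := hstat.ae_tendsto_average
    (G := fun z => max (z.2.2 - w) 0 ^ 2 - max (z.2.2 - z.2.1 - w) 0 ^ 2) (by fun_prop) j
    (hD1.sub hD2)
  have hε : ∫ ω, (Set.Ioi w).indicator (fun _ => (1 : ℝ)) ((q ω).delay (j + 1)) ∂μ =
      μ.real {ω' | w < (q ω').delay (j + 1)} := by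
    rw [hind, integral_indicator_const _ hset, smul_eq_mul, mul_one]
  rw [hε] at h5
  rw [integral_sub hD1 hD2] at h6
  have hX' : ∀ᵐ ω ∂μ, ∀ k, 1 ≤ k → 0 ≤ (q ω).X k :=
    ae_all_iff.2 fun k => eventually_imp_distrib_left.2 (hX k)
  have hSt' : ∀ᵐ ω ∂μ, ∀ k, 1 ≤ k → 0 ≤ (q ω).St k :=
    ae_all_iff.2 fun k => eventually_imp_distrib_left.2 (hSt k)
  have hSc' : ∀ᵐ ω ∂μ, ∀ k, 1 ≤ k → 0 ≤ (q ω).Sc k :=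
    ae_all_iff.2 fun k => eventually_imp_distrib_left.2 (hSc k)
  filter_upwards [hX', hSt', hSc', h1, h2, h3, h4, h5, h6] with ω a b c g1 g2 g3 g4 g5 g6
  exact TandemPath.NonnegTimes.hasTimeAverage_softAoC ⟨a, b, c⟩ hXpos g1 g2 g3 g4 g5 g6
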